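/- For a positive integer $n$, a solution of $(E)_n$ in distinct integers is a set $X$ of exactly $n$ positive integers with $\sum_{x\in X} 1/x=1$ (the order of the unknowns is disregarded). It is said to be of the form $2^\alpha q^\beta$ with $\alpha\le 2$, for an odd prime $q$, if every $x\in X$ equals $2^\alpha q^\beta$ for some integers $0\le\alpha\le 2$ and $\beta\ge 0$ depending on $x$, with the same $q$ for all $x\in X$. Let $S_q(n)$ be the set of these solutions, and let $S(n)$ be the union of the sets $S_q(n)$ over all odd primes $q$. **Theorem.** For $n=10,11,12,13$ the set $S(n)$ has respectively $101$, $192$, $363$ and $692$ elements. More precisely: 1. For $n=10,11,12,13$ the set $S_3(n)$ has respectively $100$, $190$, $362$ and $690$ elements. These are exactly the sets in the explicit list $L_n$, and no set is repeated in $L_n$. The lists $L_{10},L_{11},L_{12},L_{13}$ are written out in full in the definitions of the formal statement below (as `list10`, `list11`, `list12`, `list13`); a set $X$ is entered there as the integer $\sum_{2^\alpha 3^\beta\in X}2^{3\beta+\alpha}$ in octal notation, so that the octal digit of weight $8^\beta$ is the sum of those $2^\alpha\in\{1,2,4\}$ for which $2^\alpha 3^\beta\in X$. For example, the octal number $316$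 denotes $\{2,\,4,\,3,\,9,\,2\cdot 9\}$. 2. For $n=10,11,12,13$, the only element of $S_5(n)$ is $$U_n=\{2,\,2^2,\,5,\,5^2,\,\dots,\,5^{n-4},\,5^{n-3},\,2^2\cdot 5^{n-3}\}.$$ 3. For $n=11$ and $n=13$, the only element of $S_7(n)$ is $$V_n=\{2,\,2^2,\,7,\,2\cdot 7,\,7^2,\,2\cdot 7^2,\,\dots,\,7^{\frac{n-3}{2}},\,2\cdot 7^{\frac{n-3}{2}},\,2^2\cdot 7^{\frac{n-3}{2}}\},$$ and $S_7(10)=S_7(12)=\emptyset$. 4. There are no other solutions: $S(n)=S_3(n)\cup\{U_n\}$ for $n=10,12$ and $S(n)=S_3(n)\cup\{U_n,V_n\}$ for $n=11,13$. -/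

import Mathlib

/-- A solution of `1/x₁ + ⋯ + 1/xₙ = 1` in distinct positive integers, up to the order of the
unknowns: a set of `n` positive integers whose reciprocals sum to `1`. -/
def IsSolution (n : ℕ) (X : Finset ℕ) : Prop :=
  (∀ x ∈ X, 0 < x) ∧ X.card = n ∧ ∑ x ∈ X, (1 : ℚ) / (x : ℚ) = 1

/-- The solutions in `n` distinct positive integers all of which have the form `2 ^ α * q ^ β`
with `α ≤ 2` and `0 ≤ β`, for the given `q`. -/
def solutionsWith (q n : ℕ) : Set (Finset ℕ) :=
  {X | IsSolution n X ∧ ∀ x ∈ X, ∃ α β : ℕ, α ≤ 2 ∧ x = 2 ^ α * q ^ β}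

/-- The solutions in `n` distinct positive integers of the form `2 ^ α * q ^ β` with `α ≤ 2`,
for some odd prime `q` (the same for all the integers of one solution). -/
def solutions (n : ℕ) : Set (Finset ℕ) :=
  {X | ∃ q : ℕ, q.Prime ∧ Odd q ∧ X ∈ solutionsWith q n}

/-- `{2, 4, 5, 5 ^ 2, …, 5 ^ (n - 3), 4 * 5 ^ (n - 3)}` (used for `n ≥ 4`). -/
def U (n : ℕ) : Finset ℕ :=
  {2, 4} ∪ (Finset.Icc 1 (n - 3)).image (fun k => 5 ^ k) ∪ {4 * 5 ^ (n - 3)}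

/-- With `m = (n - 3) / 2`, the set
`{2, 4, 7, 2 * 7, 7 ^ 2, 2 * 7 ^ 2, …, 7 ^ m, 2 * 7 ^ m, 4 * 7 ^ m}` (used for odd `n ≥ 5`). -/
def V (n : ℕ) : Finset ℕ :=
  {2, 4} ∪ (Finset.Icc 1 ((n - 3) / 2)).image (fun k => 7 ^ k)
    ∪ (Finset.Icc 1 ((n - 3) / 2)).image (fun k => 2 * 7 ^ k) ∪ {4 * 7 ^ ((n - 3) / 2)}

/-- The finite set coded by `c`: the number `2 ^ α * 3 ^ β` with `α ≤ 2` belongs to it exactly when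
the binary digit of `c` at position `3 * β + α` is `1`. So the octal digit of `c` at position `β` is
the sum of the `2 ^ α ∈ {1, 2, 4}` for which `2 ^ α * 3 ^ β` belongs to the set; for example
`0o316` codes `{2, 4, 3, 9, 2 * 9}`. -/
def decode (c : ℕ) : Finset ℕ :=
  (c.bitIndices.map (fun i => 2 ^ (i % 3) * 3 ^ (i / 3))).toFinset

/-- The explicit list of 100 solutions in 10 distinct integers for `q = 3`, coded by `decode`. -/
def list10 : List (Finset ℕ) := List.map decode [
  0o311111112, 0o31111146, 0o31111426, 0o31111452, 0o3111174, 0o31114226,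
  0o31114252, 0o31114512, 0o3111706, 0o31142226, 0o31142252, 0o31142512,
  0o31145112, 0o3114546, 0o3117026, 0o3117052, 0o311734, 0o311762,
  0o31422226, 0o31422252, 0o31422512, 0o31425112, 0o3142546, 0o31451112,
  0o3145146, 0o3145426, 0o3145452, 0o314574, 0o3170226, 0o3170252,
  0o3170512, 0o317306, 0o317612, 0o34222226, 0o34222252, 0o34222512,
  0o34225112, 0o3422546, 0o34251112, 0o3425146, 0o3425426, 0o3425452,
  0o342574, 0o34511112, 0o3451146, 0o3451426, 0o3451452, 0o345174,
  0o3454226, 0o3454252, 0o3454512, 0o345706, 0o3702226, 0o3702252,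
  0o3702512, 0o3705112, 0o370546, 0o373026, 0o373052, 0o37334,
  0o37362, 0o376112, 0o37646, 0o62222226, 0o62222252, 0o62222512,
  0o62225112, 0o6222546, 0o62251112, 0o6225146, 0o6225426, 0o6225452,
  0o622574, 0o62511112, 0o6251146, 0o6251426, 0o6251452, 0o625174,
  0o6254226, 0o6254252, 0o6254512, 0o625706, 0o65111112, 0o6511146,
  0o6511426, 0o6511452, 0o651174, 0o6514226, 0o6514252, 0o6514512,
  0o651706, 0o6542226, 0o6542252, 0o6542512, 0o6545112, 0o654546,
  0o657026, 0o657052, 0o65734, 0o65762]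

/-- The explicit list of 190 solutions in 11 distinct integers for `q = 3`, coded by `decode`. -/
def list11 : List (Finset ℕ) := List.map decode [
  0o3111111112, 0o311111146, 0o311111426, 0o311111452, 0o31111174, 0o311114226,
  0o311114252, 0o311114512, 0o31111706, 0o311142226, 0o311142252, 0o311142512,
  0o311145112, 0o31114546, 0o31117026, 0o31117052, 0o3111734, 0o3111762,
  0o311422226, 0o311422252, 0o311422512, 0o311425112, 0o31142546, 0o311451112,
  0o31145146, 0o31145426, 0o31145452, 0o3114574, 0o31170226, 0o31170252,
  0o31170512, 0o3117306, 0o3117612, 0o314222226, 0o314222252, 0o314222512,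
  0o314225112, 0o31422546, 0o314251112, 0o31425146, 0o31425426, 0o31425452,
  0o3142574, 0o314511112, 0o31451146, 0o31451426, 0o31451452, 0o3145174,
  0o31454226, 0o31454252, 0o31454512, 0o3145706, 0o31702226, 0o31702252,
  0o31702512, 0o31705112, 0o3170546, 0o3173026, 0o3173052, 0o317334,
  0o317362, 0o3176112, 0o317646, 0o342222226, 0o342222252, 0o342222512,
  0o342225112, 0o34222546, 0o342251112, 0o34225146, 0o34225426, 0o34225452,
  0o3422574, 0o342511112, 0o34251146, 0o34251426, 0o34251452, 0o3425174,
  0o34254226, 0o34254252, 0o34254512, 0o3425706, 0o345111112, 0o34511146,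
  0o34511426, 0o34511452, 0o3451174, 0o34514226, 0o34514252, 0o34514512,
  0o3451706, 0o34542226, 0o34542252, 0o34542512, 0o34545112, 0o3454546,
  0o3457026, 0o3457052, 0o345734, 0o345762, 0o37022226, 0o37022252,
  0o37022512, 0o37025112, 0o3702546, 0o37051112, 0o3705146, 0o3705426,
  0o3705452, 0o370574, 0o3730226, 0o3730252, 0o3730512, 0o373306,
  0o373612, 0o3761112, 0o376146, 0o376426, 0o376452, 0o37674,
  0o622222226, 0o622222252, 0o622222512, 0o622225112, 0o62222546, 0o622251112,
  0o62225146, 0o62225426, 0o62225452, 0o6222574, 0o622511112, 0o62251146,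
  0o62251426, 0o62251452, 0o6225174, 0o62254226, 0o62254252, 0o62254512,
  0o6225706, 0o625111112, 0o62511146, 0o62511426, 0o62511452, 0o6251174,
  0o62514226, 0o62514252, 0o62514512, 0o6251706, 0o62542226, 0o62542252,
  0o62542512, 0o62545112, 0o6254546, 0o6257026, 0o6257052, 0o625734,
  0o625762, 0o651111112, 0o65111146, 0o65111426, 0o65111452, 0o6511174,
  0o65114226, 0o65114252, 0o65114512, 0o6511706, 0o65142226, 0o65142252,
  0o65142512, 0o65145112, 0o6514546, 0o6517026, 0o6517052, 0o651734,
  0o651762, 0o65422226, 0o65422252, 0o65422512, 0o65425112, 0o6542546,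
  0o65451112, 0o6545146, 0o6545426, 0o6545452, 0o654574, 0o6570226,
  0o6570252, 0o6570512, 0o657306, 0o657612]

/-- The explicit list of 362 solutions in 12 distinct integers for `q = 3`, coded by `decode`. -/
def list12 : List (Finset ℕ) := List.map decode [
  0o31111111112, 0o3111111146, 0o3111111426, 0o3111111452, 0o311111174, 0o3111114226,
  0o3111114252, 0o3111114512, 0o311111706, 0o3111142226, 0o3111142252, 0o3111142512,
  0o3111145112, 0o311114546, 0o311117026, 0o311117052, 0o31111734, 0o31111762,
  0o3111422226, 0o3111422252, 0o3111422512, 0o3111425112, 0o311142546, 0o3111451112,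
  0o311145146, 0o311145426, 0o311145452, 0o31114574, 0o311170226, 0o311170252,
  0o311170512, 0o31117306, 0o31117612, 0o3114222226, 0o3114222252, 0o3114222512,
  0o3114225112, 0o311422546, 0o3114251112, 0o311425146, 0o311425426, 0o311425452,
  0o31142574, 0o3114511112, 0o311451146, 0o311451426, 0o311451452, 0o31145174,
  0o311454226, 0o311454252, 0o311454512, 0o31145706, 0o311702226, 0o311702252,
  0o311702512, 0o311705112, 0o31170546, 0o31173026, 0o31173052, 0o3117334,
  0o3117362, 0o31176112, 0o3117646, 0o3142222226, 0o3142222252, 0o3142222512,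
  0o3142225112, 0o314222546, 0o3142251112, 0o314225146, 0o314225426, 0o314225452,
  0o31422574, 0o3142511112, 0o314251146, 0o314251426, 0o314251452, 0o31425174,
  0o314254226, 0o314254252, 0o314254512, 0o31425706, 0o3145111112, 0o314511146,
  0o314511426, 0o314511452, 0o31451174, 0o314514226, 0o314514252, 0o314514512,
  0o31451706, 0o314542226, 0o314542252, 0o314542512, 0o314545112, 0o31454546,
  0o31457026, 0o31457052, 0o3145734, 0o3145762, 0o317022226, 0o317022252,
  0o317022512, 0o317025112, 0o31702546, 0o317051112, 0o31705146, 0o31705426,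
  0o31705452, 0o3170574, 0o31730226, 0o31730252, 0o31730512, 0o3173306,
  0o3173612, 0o31761112, 0o3176146, 0o3176426, 0o3176452, 0o317674,
  0o3422222226, 0o3422222252, 0o3422222512, 0o3422225112, 0o342222546, 0o3422251112,
  0o342225146, 0o342225426, 0o342225452, 0o34222574, 0o3422511112, 0o342251146,
  0o342251426, 0o342251452, 0o34225174, 0o342254226, 0o342254252, 0o342254512,
  0o34225706, 0o3425111112, 0o342511146, 0o342511426, 0o342511452, 0o34251174,
  0o342514226, 0o342514252, 0o342514512, 0o34251706, 0o342542226, 0o342542252,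
  0o342542512, 0o342545112, 0o34254546, 0o34257026, 0o34257052, 0o3425734,
  0o3425762, 0o3451111112, 0o345111146, 0o345111426, 0o345111452, 0o34511174,
  0o345114226, 0o345114252, 0o345114512, 0o34511706, 0o345142226, 0o345142252,
  0o345142512, 0o345145112, 0o34514546, 0o34517026, 0o34517052, 0o3451734,
  0o3451762, 0o345422226, 0o345422252, 0o345422512, 0o345425112, 0o34542546,
  0o345451112, 0o34545146, 0o34545426, 0o34545452, 0o3454574, 0o34570226,
  0o34570252, 0o34570512, 0o3457306, 0o3457612, 0o370222226, 0o370222252,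
  0o370222512, 0o370225112, 0o37022546, 0o370251112, 0o37025146, 0o37025426,
  0o37025452, 0o3702574, 0o370511112, 0o37051146, 0o37051426, 0o37051452,
  0o3705174, 0o37054226, 0o37054252, 0o37054512, 0o3705706, 0o37302226,
  0o37302252, 0o37302512, 0o37305112, 0o3730546, 0o3733026, 0o3733052,
  0o373334, 0o373362, 0o3736112, 0o373646, 0o37611112, 0o3761146,
  0o3761426, 0o3761452, 0o376174, 0o3764226, 0o3764252, 0o3764512,
  0o376706, 0o6222222226, 0o6222222252, 0o6222222512, 0o6222225112, 0o622222546,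
  0o6222251112, 0o622225146, 0o622225426, 0o622225452, 0o62222574, 0o6222511112,
  0o622251146, 0o622251426, 0o622251452, 0o62225174, 0o622254226, 0o622254252,
  0o622254512, 0o62225706, 0o6225111112, 0o622511146, 0o622511426, 0o622511452,
  0o62251174, 0o622514226, 0o622514252, 0o622514512, 0o62251706, 0o622542226,
  0o622542252, 0o622542512, 0o622545112, 0o62254546, 0o62257026, 0o62257052,
  0o6225734, 0o6225762, 0o6251111112, 0o625111146, 0o625111426, 0o625111452,
  0o62511174, 0o625114226, 0o625114252, 0o625114512, 0o62511706, 0o625142226,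
  0o625142252, 0o625142512, 0o625145112, 0o62514546, 0o62517026, 0o62517052,
  0o6251734, 0o6251762, 0o625422226, 0o625422252, 0o625422512, 0o625425112,
  0o62542546, 0o625451112, 0o62545146, 0o62545426, 0o62545452, 0o6254574,
  0o62570226, 0o62570252, 0o62570512, 0o6257306, 0o6257612, 0o6511111112,
  0o651111146, 0o651111426, 0o651111452, 0o65111174, 0o651114226, 0o651114252,
  0o651114512, 0o65111706, 0o651142226, 0o651142252, 0o651142512, 0o651145112,
  0o65114546, 0o65117026, 0o65117052, 0o6511734, 0o6511762, 0o651422226,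
  0o651422252, 0o651422512, 0o651425112, 0o65142546, 0o651451112, 0o65145146,
  0o65145426, 0o65145452, 0o6514574, 0o65170226, 0o65170252, 0o65170512,
  0o6517306, 0o6517612, 0o654222226, 0o654222252, 0o654222512, 0o654225112,
  0o65422546, 0o654251112, 0o65425146, 0o65425426, 0o65425452, 0o6542574,
  0o654511112, 0o65451146, 0o65451426, 0o65451452, 0o6545174, 0o65454226,
  0o65454252, 0o65454512, 0o6545706, 0o65702226, 0o65702252, 0o65702512,
  0o65705112, 0o6570546, 0o6573026, 0o6573052, 0o657334, 0o657362,
  0o6576112, 0o657646]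

/-- The explicit list of 690 solutions in 13 distinct integers for `q = 3`, coded by `decode`. -/
def list13 : List (Finset ℕ) := List.map decode [
  0o311111111112, 0o31111111146, 0o31111111426, 0o31111111452, 0o3111111174, 0o31111114226,
  0o31111114252, 0o31111114512, 0o3111111706, 0o31111142226, 0o31111142252, 0o31111142512,
  0o31111145112, 0o3111114546, 0o3111117026, 0o3111117052, 0o311111734, 0o311111762,
  0o31111422226, 0o31111422252, 0o31111422512, 0o31111425112, 0o3111142546, 0o31111451112,
  0o3111145146, 0o3111145426, 0o3111145452, 0o311114574, 0o3111170226, 0o3111170252,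
  0o3111170512, 0o311117306, 0o311117612, 0o31114222226, 0o31114222252, 0o31114222512,
  0o31114225112, 0o3111422546, 0o31114251112, 0o3111425146, 0o3111425426, 0o3111425452,
  0o311142574, 0o31114511112, 0o3111451146, 0o3111451426, 0o3111451452, 0o311145174,
  0o3111454226, 0o3111454252, 0o3111454512, 0o311145706, 0o3111702226, 0o3111702252,
  0o3111702512, 0o3111705112, 0o311170546, 0o311173026, 0o311173052, 0o31117334,
  0o31117362, 0o311176112, 0o31117646, 0o31142222226, 0o31142222252, 0o31142222512,
  0o31142225112, 0o3114222546, 0o31142251112, 0o3114225146, 0o3114225426, 0o3114225452,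
  0o311422574, 0o31142511112, 0o3114251146, 0o3114251426, 0o3114251452, 0o311425174,
  0o3114254226, 0o3114254252, 0o3114254512, 0o311425706, 0o31145111112, 0o3114511146,
  0o3114511426, 0o3114511452, 0o311451174, 0o3114514226, 0o3114514252, 0o3114514512,
  0o311451706, 0o3114542226, 0o3114542252, 0o3114542512, 0o3114545112, 0o311454546,
  0o311457026, 0o311457052, 0o31145734, 0o31145762, 0o3117022226, 0o3117022252,
  0o3117022512, 0o3117025112, 0o311702546, 0o3117051112, 0o311705146, 0o311705426,
  0o311705452, 0o31170574, 0o311730226, 0o311730252, 0o311730512, 0o31173306,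
  0o31173612, 0o311761112, 0o31176146, 0o31176426, 0o31176452, 0o3117674,
  0o31422222226, 0o31422222252, 0o31422222512, 0o31422225112, 0o3142222546, 0o31422251112,
  0o3142225146, 0o3142225426, 0o3142225452, 0o314222574, 0o31422511112, 0o3142251146,
  0o3142251426, 0o3142251452, 0o314225174, 0o3142254226, 0o3142254252, 0o3142254512,
  0o314225706, 0o31425111112, 0o3142511146, 0o3142511426, 0o3142511452, 0o314251174,
  0o3142514226, 0o3142514252, 0o3142514512, 0o314251706, 0o3142542226, 0o3142542252,
  0o3142542512, 0o3142545112, 0o314254546, 0o314257026, 0o314257052, 0o31425734,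
  0o31425762, 0o31451111112, 0o3145111146, 0o3145111426, 0o3145111452, 0o314511174,
  0o3145114226, 0o3145114252, 0o3145114512, 0o314511706, 0o3145142226, 0o3145142252,
  0o3145142512, 0o3145145112, 0o314514546, 0o314517026, 0o314517052, 0o31451734,
  0o31451762, 0o3145422226, 0o3145422252, 0o3145422512, 0o3145425112, 0o314542546,
  0o3145451112, 0o314545146, 0o314545426, 0o314545452, 0o31454574, 0o314570226,
  0o314570252, 0o314570512, 0o31457306, 0o31457612, 0o3170222226, 0o3170222252,
  0o3170222512, 0o3170225112, 0o317022546, 0o3170251112, 0o317025146, 0o317025426,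
  0o317025452, 0o31702574, 0o3170511112, 0o317051146, 0o317051426, 0o317051452,
  0o31705174, 0o317054226, 0o317054252, 0o317054512, 0o31705706, 0o317302226,
  0o317302252, 0o317302512, 0o317305112, 0o31730546, 0o31733026, 0o31733052,
  0o3173334, 0o3173362, 0o31736112, 0o3173646, 0o317611112, 0o31761146,
  0o31761426, 0o31761452, 0o3176174, 0o31764226, 0o31764252, 0o31764512,
  0o3176706, 0o34222222226, 0o34222222252, 0o34222222512, 0o34222225112, 0o3422222546,
  0o34222251112, 0o3422225146, 0o3422225426, 0o3422225452, 0o342222574, 0o34222511112,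
  0o3422251146, 0o3422251426, 0o3422251452, 0o342225174, 0o3422254226, 0o3422254252,
  0o3422254512, 0o342225706, 0o34225111112, 0o3422511146, 0o3422511426, 0o3422511452,
  0o342251174, 0o3422514226, 0o3422514252, 0o3422514512, 0o342251706, 0o3422542226,
  0o3422542252, 0o3422542512, 0o3422545112, 0o342254546, 0o342257026, 0o342257052,
  0o34225734, 0o34225762, 0o34251111112, 0o3425111146, 0o3425111426, 0o3425111452,
  0o342511174, 0o3425114226, 0o3425114252, 0o3425114512, 0o342511706, 0o3425142226,
  0o3425142252, 0o3425142512, 0o3425145112, 0o342514546, 0o342517026, 0o342517052,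
  0o34251734, 0o34251762, 0o3425422226, 0o3425422252, 0o3425422512, 0o3425425112,
  0o342542546, 0o3425451112, 0o342545146, 0o342545426, 0o342545452, 0o34254574,
  0o342570226, 0o342570252, 0o342570512, 0o34257306, 0o34257612, 0o34511111112,
  0o3451111146, 0o3451111426, 0o3451111452, 0o345111174, 0o3451114226, 0o3451114252,
  0o3451114512, 0o345111706, 0o3451142226, 0o3451142252, 0o3451142512, 0o3451145112,
  0o345114546, 0o345117026, 0o345117052, 0o34511734, 0o34511762, 0o3451422226,
  0o3451422252, 0o3451422512, 0o3451425112, 0o345142546, 0o3451451112, 0o345145146,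
  0o345145426, 0o345145452, 0o34514574, 0o345170226, 0o345170252, 0o345170512,
  0o34517306, 0o34517612, 0o3454222226, 0o3454222252, 0o3454222512, 0o3454225112,
  0o345422546, 0o3454251112, 0o345425146, 0o345425426, 0o345425452, 0o34542574,
  0o3454511112, 0o345451146, 0o345451426, 0o345451452, 0o34545174, 0o345454226,
  0o345454252, 0o345454512, 0o34545706, 0o345702226, 0o345702252, 0o345702512,
  0o345705112, 0o34570546, 0o34573026, 0o34573052, 0o3457334, 0o3457362,
  0o34576112, 0o3457646, 0o3702222226, 0o3702222252, 0o3702222512, 0o3702225112,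
  0o370222546, 0o3702251112, 0o370225146, 0o370225426, 0o370225452, 0o37022574,
  0o3702511112, 0o370251146, 0o370251426, 0o370251452, 0o37025174, 0o370254226,
  0o370254252, 0o370254512, 0o37025706, 0o3705111112, 0o370511146, 0o370511426,
  0o370511452, 0o37051174, 0o370514226, 0o370514252, 0o370514512, 0o37051706,
  0o370542226, 0o370542252, 0o370542512, 0o370545112, 0o37054546, 0o37057026,
  0o37057052, 0o3705734, 0o3705762, 0o373022226, 0o373022252, 0o373022512,
  0o373025112, 0o37302546, 0o373051112, 0o37305146, 0o37305426, 0o37305452,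
  0o3730574, 0o37330226, 0o37330252, 0o37330512, 0o3733306, 0o3733612,
  0o37361112, 0o3736146, 0o3736426, 0o3736452, 0o373674, 0o376111112,
  0o37611146, 0o37611426, 0o37611452, 0o3761174, 0o37614226, 0o37614252,
  0o37614512, 0o3761706, 0o37642226, 0o37642252, 0o37642512, 0o37645112,
  0o3764546, 0o3767026, 0o3767052, 0o376734, 0o376762, 0o62222222226,
  0o62222222252, 0o62222222512, 0o62222225112, 0o6222222546, 0o62222251112, 0o6222225146,
  0o6222225426, 0o6222225452, 0o622222574, 0o62222511112, 0o6222251146, 0o6222251426,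
  0o6222251452, 0o622225174, 0o6222254226, 0o6222254252, 0o6222254512, 0o622225706,
  0o62225111112, 0o6222511146, 0o6222511426, 0o6222511452, 0o622251174, 0o6222514226,
  0o6222514252, 0o6222514512, 0o622251706, 0o6222542226, 0o6222542252, 0o6222542512,
  0o6222545112, 0o622254546, 0o622257026, 0o622257052, 0o62225734, 0o62225762,
  0o62251111112, 0o6225111146, 0o6225111426, 0o6225111452, 0o622511174, 0o6225114226,
  0o6225114252, 0o6225114512, 0o622511706, 0o6225142226, 0o6225142252, 0o6225142512,
  0o6225145112, 0o622514546, 0o622517026, 0o622517052, 0o62251734, 0o62251762,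
  0o6225422226, 0o6225422252, 0o6225422512, 0o6225425112, 0o622542546, 0o6225451112,
  0o622545146, 0o622545426, 0o622545452, 0o62254574, 0o622570226, 0o622570252,
  0o622570512, 0o62257306, 0o62257612, 0o62511111112, 0o6251111146, 0o6251111426,
  0o6251111452, 0o625111174, 0o6251114226, 0o6251114252, 0o6251114512, 0o625111706,
  0o6251142226, 0o6251142252, 0o6251142512, 0o6251145112, 0o625114546, 0o625117026,
  0o625117052, 0o62511734, 0o62511762, 0o6251422226, 0o6251422252, 0o6251422512,
  0o6251425112, 0o625142546, 0o6251451112, 0o625145146, 0o625145426, 0o625145452,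
  0o62514574, 0o625170226, 0o625170252, 0o625170512, 0o62517306, 0o62517612,
  0o6254222226, 0o6254222252, 0o6254222512, 0o6254225112, 0o625422546, 0o6254251112,
  0o625425146, 0o625425426, 0o625425452, 0o62542574, 0o6254511112, 0o625451146,
  0o625451426, 0o625451452, 0o62545174, 0o625454226, 0o625454252, 0o625454512,
  0o62545706, 0o625702226, 0o625702252, 0o625702512, 0o625705112, 0o62570546,
  0o62573026, 0o62573052, 0o6257334, 0o6257362, 0o62576112, 0o6257646,
  0o65111111112, 0o6511111146, 0o6511111426, 0o6511111452, 0o651111174, 0o6511114226,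
  0o6511114252, 0o6511114512, 0o651111706, 0o6511142226, 0o6511142252, 0o6511142512,
  0o6511145112, 0o651114546, 0o651117026, 0o651117052, 0o65111734, 0o65111762,
  0o6511422226, 0o6511422252, 0o6511422512, 0o6511425112, 0o651142546, 0o6511451112,
  0o651145146, 0o651145426, 0o651145452, 0o65114574, 0o651170226, 0o651170252,
  0o651170512, 0o65117306, 0o65117612, 0o6514222226, 0o6514222252, 0o6514222512,
  0o6514225112, 0o651422546, 0o6514251112, 0o651425146, 0o651425426, 0o651425452,
  0o65142574, 0o6514511112, 0o651451146, 0o651451426, 0o651451452, 0o65145174,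
  0o651454226, 0o651454252, 0o651454512, 0o65145706, 0o651702226, 0o651702252,
  0o651702512, 0o651705112, 0o65170546, 0o65173026, 0o65173052, 0o6517334,
  0o6517362, 0o65176112, 0o6517646, 0o6542222226, 0o6542222252, 0o6542222512,
  0o6542225112, 0o654222546, 0o6542251112, 0o654225146, 0o654225426, 0o654225452,
  0o65422574, 0o6542511112, 0o654251146, 0o654251426, 0o654251452, 0o65425174,
  0o654254226, 0o654254252, 0o654254512, 0o65425706, 0o6545111112, 0o654511146,
  0o654511426, 0o654511452, 0o65451174, 0o654514226, 0o654514252, 0o654514512,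
  0o65451706, 0o654542226, 0o654542252, 0o654542512, 0o654545112, 0o65454546,
  0o65457026, 0o65457052, 0o6545734, 0o6545762, 0o657022226, 0o657022252,
  0o657022512, 0o657025112, 0o65702546, 0o657051112, 0o65705146, 0o65705426,
  0o65705452, 0o6570574, 0o65730226, 0o65730252, 0o65730512, 0o6573306,
  0o6573612, 0o65761112, 0o6576146, 0o6576426, 0o6576452, 0o657674]

/-- The elements of `{1, 2, 4}` selected by the binary digits of `d`. -/
def block (d : ℕ) : Finset ℕ :=
  ((Finset.range 3).filter (fun i => d.testBit i = true)).image (2 ^ ·)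

/-- The sum of `4 / x` over `x ∈ block d`, for `d < 8`. -/
def blockWeight (d : ℕ) : ℕ := 4 * (d % 2) + 2 * (d / 2 % 2) + d / 4

/-- The number of elements of `block d`, for `d < 8`. -/
def blockCard (d : ℕ) : ℕ := d % 2 + d / 2 % 2 + d / 4

/-- Every element of `X` is `2 ^ α * q ^ β` with `α ≤ 2`. -/
def HasForm (q : ℕ) (X : Finset ℕ) : Prop := ∀ x ∈ X, ∃ α β : ℕ, α ≤ 2 ∧ x = 2 ^ α * q ^ β

theorem block_subset (d : ℕ) : block d ⊆ {1, 2, 4} := by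
  intro x hx
  simp only [block, Finset.mem_image, Finset.mem_filter, Finset.mem_range] at hx
  obtain ⟨i, ⟨hi, -⟩, rfl⟩ := hx
  interval_cases i <;> simp

theorem exists_block_eq {s : Finset ℕ} (hs : s ⊆ {1, 2, 4}) : ∃ d < 8, block d = s := by
  have h : ∀ s ∈ ({1, 2, 4} : Finset ℕ).powerset, ∃ d < 8, block d = s := by decide
  exact h s (Finset.mem_powerset.2 hs)

theorem card_block {d : ℕ} (hd : d < 8) : (block d).card = blockCard d := by
  revert d; decide

theorem sum_block {d : ℕ} (hd : d < 8) : ∑ x ∈ block d, (4 : ℚ) / x = blockWeight d := by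
  have h : ∀ d < 8, ∑ x ∈ block d, 4 / x = blockWeight d := by decide
  rw [← h d hd, Nat.cast_sum]
  refine Finset.sum_congr rfl fun x hx => ?_
  have := block_subset d hx
  simp only [Finset.mem_insert, Finset.mem_singleton] at this
  rcases this with rfl | rfl | rfl <;> norm_num

theorem hasForm_block (q d : ℕ) : HasForm q (block d) := by
  intro x hx
  have := block_subset d hx
  simp only [Finset.mem_insert, Finset.mem_singleton] at this
  rcases this with rfl | rfl | rfl
  exacts [⟨0, 0, by simp⟩, ⟨1, 0, by simp⟩, ⟨2, 0, by simp⟩]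

theorem disjoint_block_image {q : ℕ} (hq : 3 ≤ q) (hodd : Odd q) (d : ℕ) (Y : Finset ℕ) :
    Disjoint (block d) (Y.image (q * ·)) := by
  rw [Finset.disjoint_left]
  intro x hx hy
  obtain ⟨y, -, rfl⟩ := Finset.mem_image.1 hy
  have h := block_subset d hx
  simp only [Finset.mem_insert, Finset.mem_singleton] at h
  have h4 : q ∣ 4 := by
    rcases h with h | h | h
    · exact (Dvd.intro y h).trans (by norm_num)
    · exact (Dvd.intro y h).trans (by norm_num)
    · exact Dvd.intro y h
  have : q ≤ 4 := Nat.le_of_dvd (by norm_num) h4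
  interval_cases q
  · omega
  · exact absurd hodd (by decide)

theorem mul_left_injective_of_three_le {q : ℕ} (hq : 3 ≤ q) :
    Function.Injective (fun y : ℕ => q * y) := fun a b h =>
  Nat.eq_of_mul_eq_mul_left (by omega) h

theorem card_block_union {q : ℕ} (hq : 3 ≤ q) (hodd : Odd q) {d : ℕ} (hd : d < 8)
    (Y : Finset ℕ) : (block d ∪ Y.image (q * ·)).card = blockCard d + Y.card := by
  rw [Finset.card_union_of_disjoint (disjoint_block_image hq hodd d Y), card_block hd,
    Finset.card_image_of_injective _ (mul_left_injective_of_three_le hq)]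

theorem sum_block_union {q : ℕ} (hq : 3 ≤ q) (hodd : Odd q) {d : ℕ} (hd : d < 8)
    (Y : Finset ℕ) : ∑ x ∈ block d ∪ Y.image (q * ·), (4 : ℚ) / x =
      blockWeight d + (∑ y ∈ Y, (4 : ℚ) / y) / q := by
  rw [Finset.sum_union (disjoint_block_image hq hodd d Y), sum_block hd,
    Finset.sum_image (mul_left_injective_of_three_le hq).injOn, Finset.sum_div]
  congr 1
  refine Finset.sum_congr rfl fun y _ => ?_
  push_cast
  rw [div_div, mul_comm]

theorem HasForm.pos {q : ℕ} (hq : 3 ≤ q) {X : Finset ℕ} (hX : HasForm q X) {x : ℕ} (hx : x ∈ X) :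
    0 < x := by
  obtain ⟨α, β, -, rfl⟩ := hX x hx
  positivity

theorem HasForm.block_union {q : ℕ} {Y : Finset ℕ} (hY : HasForm q Y) (d : ℕ) :
    HasForm q (block d ∪ Y.image (q * ·)) := by
  intro x hx
  rcases Finset.mem_union.1 hx with hx | hx
  · exact hasForm_block q d x hx
  · obtain ⟨y, hy, rfl⟩ := Finset.mem_image.1 hx
    obtain ⟨α, β, hα, rfl⟩ := hY y hy
    exact ⟨α, β + 1, hα, by ring⟩

theorem HasForm.exists_block_union {q : ℕ} (hq : 3 ≤ q) {X : Finset ℕ} (hX : HasForm q X) :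
    ∃ d < 8, ∃ Y : Finset ℕ, HasForm q Y ∧ X = block d ∪ Y.image (q * ·) := by
  classical
  obtain ⟨d, hd, hdX⟩ := exists_block_eq (s := X ∩ {1, 2, 4}) Finset.inter_subset_right
  refine ⟨d, hd, ((X \ {1, 2, 4}).image (· / q)), ?_, ?_⟩
  all_goals
    have key : ∀ x ∈ X \ {1, 2, 4}, ∃ α β : ℕ, α ≤ 2 ∧ x = q * (2 ^ α * q ^ β) := by
      intro x hx
      rw [Finset.mem_sdiff] at hx
      obtain ⟨α, β, hα, rfl⟩ := hX x hx.1
      cases β with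
      | zero => exact absurd (by interval_cases α <;> simp) hx.2
      | succ β => exact ⟨α, β, hα, by ring⟩
  · intro y hy
    obtain ⟨x, hx, rfl⟩ := Finset.mem_image.1 hy
    obtain ⟨α, β, hα, rfl⟩ := key x hx
    exact ⟨α, β, hα, Nat.mul_div_cancel_left _ (by omega)⟩
  · rw [hdX, Finset.image_image]
    have : (X \ {1, 2, 4}).image ((q * ·) ∘ (· / q)) = X \ {1, 2, 4} := by
      conv_rhs => rw [← Finset.image_id (s := X \ {1, 2, 4})]
      refine Finset.image_congr fun x hx => ?_
      obtain ⟨α, β, hα, rfl⟩ := key x hx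
      simp [Nat.mul_div_cancel_left _ (show 0 < q by omega)]
    rw [this, Finset.union_comm, Finset.sdiff_union_inter]

theorem sum_four_div_nonneg (X : Finset ℕ) : 0 ≤ ∑ x ∈ X, (4 : ℚ) / x :=
  Finset.sum_nonneg fun _ _ => by positivity

theorem HasForm.sum_mul_le {q : ℕ} (hq : 3 ≤ q) (hodd : Odd q) {X : Finset ℕ}
    (hX : HasForm q X) : (∑ x ∈ X, (4 : ℚ) / x) * (q - 1) ≤ 7 * q := by
  obtain ⟨N, hN⟩ : ∃ N, ∀ x ∈ X, x < N :=
    ⟨X.sup id + 1, fun x hx => Nat.lt_succ_of_le (Finset.le_sup (f := id) hx)⟩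
  induction N generalizing X with
  | zero =>
    have : X = ∅ := Finset.eq_empty_of_forall_notMem fun x hx => by simpa using hN x hx
    subst this
    simp
  | succ N ih =>
    obtain ⟨d, hd, Y, hY, rfl⟩ := hX.exists_block_union hq
    have hYN : ∀ y ∈ Y, y < N := by
      intro y hy
      have h1 := hN (q * y) (Finset.mem_union_right _ (Finset.mem_image_of_mem _ hy))
      have h2 := hY.pos hq hy
      nlinarith
    have h := ih hY hYN
    rw [sum_block_union hq hodd hd]
    have hw : (blockWeight d : ℚ) ≤ 7 := by
      have : blockWeight d ≤ 7 := by unfold blockWeight; omega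
      exact_mod_cast this
    have hq' : (3 : ℚ) ≤ q := by exact_mod_cast hq
    have h2 : (∑ y ∈ Y, (4 : ℚ) / y) / q * (q - 1) ≤ 7 := by
      rw [div_mul_eq_mul_div, div_le_iff₀ (by linarith)]
      exact h
    nlinarith

/-- `X` consists of `n` numbers `2 ^ α * q ^ β` with `α ≤ 2`, and the sum of `4 / x` is `r`. -/
def IsRepr (q r n : ℕ) (X : Finset ℕ) : Prop :=
  HasForm q X ∧ X.card = n ∧ ∑ x ∈ X, (4 : ℚ) / x = r

theorem IsRepr.mul_le {q r n : ℕ} (hq : 3 ≤ q) (hodd : Odd q) {X : Finset ℕ}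
    (hX : IsRepr q r n X) : r * (q - 1) ≤ 7 * q := by
  have h := hX.1.sum_mul_le hq hodd
  rw [hX.2.2] at h
  have : ((r * (q - 1) : ℕ) : ℚ) ≤ (7 * q : ℕ) := by
    push_cast [Nat.cast_sub (show 1 ≤ q by omega)]
    exact h
  exact_mod_cast this

theorem isRepr_zero_iff {q n : ℕ} (hq : 3 ≤ q) {X : Finset ℕ} :
    IsRepr q 0 n X ↔ n = 0 ∧ X = ∅ := by
  constructor
  · rintro ⟨hF, rfl, hs⟩
    have : X = ∅ := by
      refine Finset.eq_empty_of_forall_notMem fun x hx => ?_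
      have h1 := (Finset.sum_eq_zero_iff_of_nonneg (fun _ _ => by positivity)).1
        (hs.trans Nat.cast_zero) x hx
      have h2 : (0 : ℚ) < x := by exact_mod_cast hF.pos hq hx
      have : (0 : ℚ) < 4 / x := by positivity
      exact this.ne' h1
    simp [this]
  · rintro ⟨rfl, rfl⟩
    exact ⟨fun x hx => by simp at hx, by simp, by simp⟩

theorem IsRepr.exists_block_union {q r n : ℕ} (hq : 3 ≤ q) (hodd : Odd q) {X : Finset ℕ}
    (hX : IsRepr q r n X) : ∃ d < 8, blockWeight d ≤ r ∧ blockCard d ≤ n ∧ ∃ Y,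
      IsRepr q (q * (r - blockWeight d)) (n - blockCard d) Y ∧ X = block d ∪ Y.image (q * ·) := by
  obtain ⟨hF, hc, hs⟩ := hX
  obtain ⟨d, hd, Y, hY, rfl⟩ := hF.exists_block_union hq
  rw [card_block_union hq hodd hd] at hc
  rw [sum_block_union hq hodd hd] at hs
  have hq0 : (0 : ℚ) < q := by exact_mod_cast (show 0 < q by omega)
  have hw : blockWeight d ≤ r := by
    have : (0 : ℚ) ≤ (∑ y ∈ Y, (4 : ℚ) / y) / q := div_nonneg (sum_four_div_nonneg Y) hq0.le
    have : (blockWeight d : ℚ) ≤ r := by linarith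
    exact_mod_cast this
  refine ⟨d, hd, hw, by omega, Y, ⟨hY, by omega, ?_⟩, rfl⟩
  push_cast [Nat.cast_sub hw]
  rw [← hs]
  field_simp
  ring

theorem IsRepr.block_union {q r n d : ℕ} (hq : 3 ≤ q) (hodd : Odd q) (hd : d < 8)
    (hr : blockWeight d ≤ r) (hn : blockCard d ≤ n) {Y : Finset ℕ}
    (hY : IsRepr q (q * (r - blockWeight d)) (n - blockCard d) Y) :
    IsRepr q r n (block d ∪ Y.image (q * ·)) := by
  obtain ⟨hF, hc, hs⟩ := hY
  refine ⟨hF.block_union d, ?_, ?_⟩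
  · rw [card_block_union hq hodd hd]
    omega
  · have hq0 : (0 : ℚ) < q := by exact_mod_cast (show 0 < q by omega)
    rw [sum_block_union hq hodd hd, hs]
    push_cast [Nat.cast_sub hr]
    field_simp
    ring

/-- The number of sets of `n` numbers `2 ^ α * q ^ β` with `α ≤ 2` for which the sum of `4 / x`
is `r`, counted block by block; the first argument bounds the number of blocks. -/
def reprCount (q : ℕ) : ℕ → ℕ → ℕ → ℕ
  | 0, _, _ => 0
  | k + 1, r, n =>
    bif r.beq 0 then (bif n.beq 0 then 1 else 0)
    else
      let t w c := bif w.ble r && c.ble n && ((r - w) * (q - 1)).ble 7 then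
        reprCount q k (q * (r - w)) (n - c) else 0
      t 0 0 + t 4 1 + t 2 1 + t 6 2 + t 1 1 + t 5 2 + t 3 2 + t 7 3

theorem reprCount_succ_zero (q k n : ℕ) :
    reprCount q (k + 1) 0 n = if n = 0 then 1 else 0 := by
  cases n <;> rfl

theorem reprCount_succ {q k r n : ℕ} (hr : r ≠ 0) : reprCount q (k + 1) r n =
    ∑ d ∈ Finset.range 8,
      if blockWeight d ≤ r ∧ blockCard d ≤ n ∧ (r - blockWeight d) * (q - 1) ≤ 7 then
        reprCount q k (q * (r - blockWeight d)) (n - blockCard d) else 0 := by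
  have h : ∀ w c : ℕ, (bif w.ble r && c.ble n && ((r - w) * (q - 1)).ble 7 then
      reprCount q k (q * (r - w)) (n - c) else 0) =
      if w ≤ r ∧ c ≤ n ∧ (r - w) * (q - 1) ≤ 7 then
        reprCount q k (q * (r - w)) (n - c) else 0 := by
    intro w c
    simp only [Bool.cond_eq_ite, Bool.and_eq_true, Nat.ble_eq, and_assoc]
  have h0 : r.beq 0 = false := by
    cases r
    exacts [absurd rfl hr, rfl]
  rw [reprCount, h0]
  simp only [cond_false, h, Finset.sum_range_succ, Finset.sum_range_zero, zero_add]
  rfl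

theorem exists_finset_card_le_reprCount {q : ℕ} (hq : 3 ≤ q) (hodd : Odd q) {k r n : ℕ}
    (hk : 11 * n + 10 - r < k) : ∃ S : Finset (Finset ℕ),
      (∀ X, IsRepr q r n X → X ∈ S) ∧ S.card ≤ reprCount q k r n := by
  induction k generalizing r n with
  | zero => omega
  | succ k ih =>
    have le_ten : ∀ {r}, r * (q - 1) ≤ 7 * q → r ≤ 10 := by
      intro r h
      by_contra! hr
      obtain ⟨p, rfl⟩ : ∃ p, q = p + 1 := ⟨q - 1, by omega⟩
      simp only [Nat.add_sub_cancel] at h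
      nlinarith
    rcases Nat.eq_zero_or_pos r with rfl | hr0
    · rw [reprCount_succ_zero]
      split_ifs with h
      · exact ⟨{∅}, fun X hX => by simp [((isRepr_zero_iff hq).1 hX).2], by simp⟩
      · exact ⟨∅, fun X hX => absurd ((isRepr_zero_iff hq).1 hX).1 h, by simp⟩
    by_cases hr : r ≤ 10
    swap
    · exact ⟨∅, fun X hX => absurd (le_ten (hX.mul_le hq hodd)) hr, by simp⟩
    have step : ∀ d ∈ Finset.range 8, ∃ S : Finset (Finset ℕ),
        (∀ Y, blockWeight d ≤ r → blockCard d ≤ n →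
          IsRepr q (q * (r - blockWeight d)) (n - blockCard d) Y →
            block d ∪ Y.image (q * ·) ∈ S) ∧
        S.card ≤ if blockWeight d ≤ r ∧ blockCard d ≤ n ∧ (r - blockWeight d) * (q - 1) ≤ 7 then
          reprCount q k (q * (r - blockWeight d)) (n - blockCard d) else 0 := by
      intro d hd
      split_ifs with h
      · have hk' : 11 * (n - blockCard d) + 10 - q * (r - blockWeight d) < k := by
          rcases Nat.eq_zero_or_pos d with rfl | hd0
          · simp only [blockWeight, blockCard] at *
            norm_num at *
            have h3 : 3 * r ≤ q * r := Nat.mul_le_mul_right r hq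
            have h2 : r * 2 ≤ r * (q - 1) := Nat.mul_le_mul_left r (by omega)
            omega
          · have : 1 ≤ blockCard d := by
              have := Finset.mem_range.1 hd
              unfold blockCard
              omega
            omega
        obtain ⟨S, hS, hc⟩ := ih hk'
        exact ⟨S.image fun Y => block d ∪ Y.image (q * ·),
          fun Y _ _ hY => Finset.mem_image_of_mem _ (hS Y hY), Finset.card_image_le.trans hc⟩
      · refine ⟨∅, fun Y hw hn hY => absurd ⟨hw, hn, ?_⟩ h, by simp⟩
        have := hY.mul_le hq hodd
        exact Nat.le_of_mul_le_mul_left (by linarith) (show 0 < q by omega)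
    choose! S hS hc using step
    refine ⟨(Finset.range 8).biUnion S, fun X hX => ?_, ?_⟩
    · obtain ⟨d, hd, hw, hn, Y, hY, rfl⟩ := hX.exists_block_union hq hodd
      have hd' := Finset.mem_range.2 hd
      exact Finset.mem_biUnion.2 ⟨d, hd', hS d hd' Y hw hn hY⟩
    · rw [reprCount_succ hr0.ne']
      exact Finset.card_biUnion_le.trans (Finset.sum_le_sum hc)

theorem mem_solutionsWith_iff_isRepr {q n : ℕ} (hq : 3 ≤ q) {X : Finset ℕ} :
    X ∈ solutionsWith q n ↔ IsRepr q 4 n X := by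
  have hsum : ∑ x ∈ X, (4 : ℚ) / x = 4 * ∑ x ∈ X, (1 : ℚ) / x := by
    rw [Finset.mul_sum]
    exact Finset.sum_congr rfl fun x _ => by ring
  constructor
  · rintro ⟨⟨-, hc, hs⟩, hF⟩
    exact ⟨hF, hc, by rw [hsum, hs]; norm_num⟩
  · rintro ⟨hF, hc, hs⟩
    rw [hsum] at hs
    exact ⟨⟨fun x hx => HasForm.pos hq hF hx, hc, by push_cast at hs; linarith⟩, hF⟩

theorem solutionsWith_eq_coe {q n : ℕ} (hq : 3 ≤ q) (hodd : Odd q) (hn : n ≤ 13)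
    {T : Finset (Finset ℕ)} (hT : ∀ X ∈ T, X ∈ solutionsWith q n)
    (hcard : reprCount q 160 4 n ≤ T.card) : solutionsWith q n = T := by
  obtain ⟨S, hS, hc⟩ := exists_finset_card_le_reprCount hq hodd (k := 160) (r := 4) (n := n)
    (by omega)
  have hsub : ∀ X ∈ solutionsWith q n, X ∈ S := fun X hX =>
    hS X ((mem_solutionsWith_iff_isRepr hq).1 hX)
  have hTS : T = S := Finset.eq_of_subset_of_card_le (fun X hX => hsub X (hT X hX))
    (hc.trans hcard)
  ext X
  exact ⟨fun hX => by rw [hTS]; exact hsub X hX, fun hX => hT X hX⟩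

theorem solutionsWith_eq_empty {q n : ℕ} (hq : 9 ≤ q) (hodd : Odd q) (hn : 2 ≤ n) :
    solutionsWith q n = ∅ := by
  refine Set.eq_empty_of_forall_notMem fun X hX => ?_
  rw [mem_solutionsWith_iff_isRepr (by omega)] at hX
  obtain ⟨d, hd, hw, hc, Y, hY, -⟩ := hX.exists_block_union (by omega) hodd
  have h := hY.mul_le (by omega) hodd
  have h4 : 4 - blockWeight d = 0 := by
    have h1 : (4 - blockWeight d) * (q - 1) ≤ 7 :=
      Nat.le_of_mul_le_mul_left (by linarith [h]) (show 0 < q by omega)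
    by_contra h0
    have := Nat.mul_le_mul (Nat.pos_of_ne_zero h0) (show 8 ≤ q - 1 by omega)
    omega
  rw [h4, Nat.mul_zero, isRepr_zero_iff (by omega)] at hY
  have h5 : blockWeight d = 4 := by omega
  have : ∀ d < 8, blockWeight d = 4 → blockCard d = 1 := by decide
  have := this d hd h5
  omega

theorem mem_decode {c x : ℕ} :
    x ∈ decode c ↔ ∃ i, c.testBit i = true ∧ 2 ^ (i % 3) * 3 ^ (i / 3) = x := by
  simp [decode]

theorem decode_eq_block_union (c : ℕ) :
    decode c = block (c % 8) ∪ (decode (c / 8)).image (3 * ·) := by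
  have hbit : ∀ i, c.testBit i =
      if i < 3 then (c % 8).testBit i else (c / 8).testBit (i - 3) := by
    intro i
    rw [← Nat.testBit_two_pow_mul_add (c / 8) (Nat.mod_lt c (by norm_num : 8 > 0)) i]
    congr 1
    omega
  ext x
  simp only [Finset.mem_union, Finset.mem_image, mem_decode, block, Finset.mem_filter,
    Finset.mem_range]
  constructor
  · rintro ⟨i, hi, rfl⟩
    rw [hbit] at hi
    split_ifs at hi with h
    · exact Or.inl ⟨i, ⟨h, hi⟩, by rw [Nat.mod_eq_of_lt h, Nat.div_eq_of_lt h]; simp⟩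
    · refine Or.inr ⟨_, ⟨i - 3, hi, rfl⟩, ?_⟩
      obtain ⟨j, rfl⟩ : ∃ j, i = j + 3 := ⟨i - 3, by omega⟩
      rw [Nat.add_sub_cancel, Nat.add_mod_right, Nat.add_div_right _ (by norm_num)]
      ring
  · rintro (⟨i, ⟨h, hi⟩, rfl⟩ | ⟨y, ⟨i, hi, rfl⟩, rfl⟩)
    · exact ⟨i, by rw [hbit, if_pos h, hi],
        by rw [Nat.mod_eq_of_lt h, Nat.div_eq_of_lt h]; simp⟩
    · refine ⟨i + 3, by rw [hbit, if_neg (by omega), Nat.add_sub_cancel, hi], ?_⟩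
      rw [Nat.add_mod_right, Nat.add_div_right _ (by norm_num)]
      ring

theorem decode_injective : Function.Injective decode := by
  have hg : Function.Injective (fun i : ℕ => 2 ^ (i % 3) * 3 ^ (i / 3)) := by
    intro i j hij
    have h2 : i % 3 = j % 3 := by
      have := congrArg (fun m => m.factorization 2) hij
      simpa [Nat.factorization_mul, Nat.prime_two.factorization, Nat.prime_three.factorization]
        using this
    have h3 : i / 3 = j / 3 := by
      have := congrArg (fun m => m.factorization 3) hij
      simpa [Nat.factorization_mul, Nat.prime_two.factorization, Nat.prime_three.factorization]
        using this
    omega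
  have h : ∀ c, decode c =
      (Finset.equivBitIndices c).image (fun i : ℕ => 2 ^ (i % 3) * 3 ^ (i / 3)) := by
    intro c
    ext x
    simp [decode]
  intro c c' hc
  rw [h, h] at hc
  exact Finset.equivBitIndices.injective (Finset.image_injective hg hc)

/-- Checks with `k` octal digits that `c` codes `n` numbers `x` for which the sum of `4 / x`
is `r`. -/
def checkCode : ℕ → ℕ → ℕ → ℕ → Bool
  | 0, c, r, n => c.beq 0 && r.beq 0 && n.beq 0
  | k + 1, c, r, n =>
    (blockWeight (c % 8)).ble r && (blockCard (c % 8)).ble n &&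
      checkCode k (c / 8) (3 * (r - blockWeight (c % 8))) (n - blockCard (c % 8))

theorem isRepr_decode {k c r n : ℕ} (h : checkCode k c r n = true) :
    IsRepr 3 r n (decode c) := by
  induction k generalizing c r n with
  | zero =>
    simp only [checkCode, Bool.and_eq_true, Nat.beq_eq] at h
    obtain ⟨⟨rfl, rfl⟩, rfl⟩ := h
    exact (isRepr_zero_iff le_rfl).2 ⟨rfl, by simp [decode]⟩
  | succ k ih =>
    simp only [checkCode, Bool.and_eq_true, Nat.ble_eq] at h
    rw [decode_eq_block_union]
    exact (ih h.2).block_union le_rfl (by decide) (Nat.mod_lt _ (by norm_num)) h.1.1 h.1.2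

/-- Multiplies `c` by powers of `8`, at most `k` times, until it has more than twelve octal
digits, so that the codes are compared by their leading octal digits first. -/
def octalAlign : ℕ → ℕ → ℕ
  | 0, c => c
  | k + 1, c => bif (8 ^ 12).ble c then c else octalAlign k (8 * c)

theorem solutionsWith_three_eq {n : ℕ} (hn : n ≤ 13) {codes : List ℕ}
    (hcheck : (codes.all fun c => checkCode 14 c 4 n) = true)
    (hsorted : (codes.map (octalAlign 13)).IsChain (· < ·))
    (hcount : reprCount 3 160 4 n ≤ codes.length) :
    solutionsWith 3 n = {X | X ∈ codes.map decode} ∧ (codes.map decode).Nodup := by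
  have hnodup : (codes.map decode).Nodup :=
    (List.Nodup.of_map _ hsorted.pairwise.nodup).map decode_injective
  refine ⟨?_, hnodup⟩
  rw [solutionsWith_eq_coe (T := (codes.map decode).toFinset) le_rfl (by decide) hn]
  · ext X
    simp
  · intro X hX
    obtain ⟨c, hc, rfl⟩ := List.mem_map.1 (List.mem_toFinset.1 hX)
    rw [mem_solutionsWith_iff_isRepr le_rfl]
    exact isRepr_decode (List.all_eq_true.1 hcheck c hc)
  · rwa [List.toFinset_card_of_nodup hnodup, List.length_map]

theorem ncard_setOf_mem {α : Type*} {L : List α} (hL : L.Nodup) :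
    {x | x ∈ L}.ncard = L.length := by
  classical
  rw [← List.toFinset_card_of_nodup hL, ← Set.ncard_coe_finset]
  congr 1
  ext x
  simp

theorem solutionsWith_three_ten :
    solutionsWith 3 10 = {X | X ∈ list10} ∧ list10.Nodup :=
  solutionsWith_three_eq (by norm_num) (by decide +kernel) (by decide +kernel) (by decide +kernel)

theorem solutionsWith_three_eleven :
    solutionsWith 3 11 = {X | X ∈ list11} ∧ list11.Nodup :=
  solutionsWith_three_eq (by norm_num) (by decide +kernel) (by decide +kernel) (by decide +kernel)

theorem solutionsWith_three_twelve :
    solutionsWith 3 12 = {X | X ∈ list12} ∧ list12.Nodup :=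
  solutionsWith_three_eq (by norm_num) (by decide +kernel) (by decide +kernel) (by decide +kernel)

theorem solutionsWith_three_thirteen :
    solutionsWith 3 13 = {X | X ∈ list13} ∧ list13.Nodup :=
  solutionsWith_three_eq (by norm_num) (by decide +kernel) (by decide +kernel) (by decide +kernel)

theorem mem_solutionsWith_of_bounded {q n : ℕ} {X : Finset ℕ}
    (h : (∀ x ∈ X, 0 < x) ∧ X.card = n ∧ ∑ x ∈ X, (1 : ℚ) / (x : ℚ) = 1)
    (hF : ∀ x ∈ X, ∃ α < 3, ∃ β < 14, x = 2 ^ α * q ^ β) : X ∈ solutionsWith q n := by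
  refine ⟨h, fun x hx => ?_⟩
  obtain ⟨α, hα, β, -, h⟩ := hF x hx
  exact ⟨α, β, by omega, h⟩

theorem solutionsWith_eq_singleton {q n : ℕ} (hq : 3 ≤ q) (hodd : Odd q) (hn : n ≤ 13)
    {X : Finset ℕ} (h : (∀ x ∈ X, 0 < x) ∧ X.card = n ∧ ∑ x ∈ X, (1 : ℚ) / (x : ℚ) = 1)
    (hF : ∀ x ∈ X, ∃ α < 3, ∃ β < 14, x = 2 ^ α * q ^ β) (hcount : reprCount q 160 4 n ≤ 1) :
    solutionsWith q n = {X} := by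
  rw [solutionsWith_eq_coe (T := {X}) hq hodd hn, Finset.coe_singleton]
  · intro Y hY
    rw [Finset.mem_singleton.1 hY]
    exact mem_solutionsWith_of_bounded h hF
  · simpa using hcount

theorem solutionsWith_five {n : ℕ} (hn : n ∈ [10, 11, 12, 13]) : solutionsWith 5 n = {U n} := by
  have hn' : n ≤ 13 := by revert n; decide
  refine solutionsWith_eq_singleton (by norm_num) (by decide) hn' ?_ ?_ ?_
  all_goals revert n; decide +kernel

theorem solutionsWith_seven_of_odd {n : ℕ} (hn : n ∈ [11, 13]) : solutionsWith 7 n = {V n} := by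
  have hn' : n ≤ 13 := by revert n; decide
  refine solutionsWith_eq_singleton (by norm_num) (by decide) hn' ?_ ?_ ?_
  all_goals revert n; decide +kernel

theorem solutionsWith_seven_of_even {n : ℕ} (hn : n ∈ [10, 12]) : solutionsWith 7 n = ∅ := by
  rw [solutionsWith_eq_coe (T := ∅) (by norm_num) (by decide) (by revert n; decide) (by simp),
    Finset.coe_empty]
  revert n
  decide +kernel

theorem solutions_eq_union {n : ℕ} (hn : 2 ≤ n) :
    solutions n = solutionsWith 3 n ∪ solutionsWith 5 n ∪ solutionsWith 7 n := by
  ext X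
  constructor
  · rintro ⟨q, hp, hodd, hX⟩
    by_cases h9 : 9 ≤ q
    · rw [solutionsWith_eq_empty h9 hodd hn] at hX
      exact absurd hX (Set.notMem_empty X)
    · have := hp.two_le
      interval_cases q
      · exact absurd hodd (by decide)
      · exact Or.inl (Or.inl hX)
      · exact absurd hodd (by decide)
      · exact Or.inl (Or.inr hX)
      · exact absurd hodd (by decide)
      · exact Or.inr hX
      · exact absurd hodd (by decide)
  · rintro ((hX | hX) | hX)
    exacts [⟨3, by norm_num, by decide, hX⟩, ⟨5, by norm_num, by decide, hX⟩,
      ⟨7, by norm_num, by decide, hX⟩]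

theorem notMem_solutionsWith_three {p n : ℕ} (hp : p.Prime) (h5 : 5 ≤ p) {X : Finset ℕ}
    (hX : p ∈ X) : X ∉ solutionsWith 3 n := by
  rintro ⟨-, hF⟩
  obtain ⟨α, β, -, h⟩ := hF p hX
  have hdvd : p ∣ 2 ^ α * 3 ^ β := h ▸ dvd_rfl
  rcases hp.dvd_mul.1 hdvd with h | h
  · exact absurd (Nat.le_of_dvd (by norm_num) (hp.dvd_of_dvd_pow h)) (by omega)
  · exact absurd (Nat.le_of_dvd (by norm_num) (hp.dvd_of_dvd_pow h)) (by omega)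

theorem U_notMem_solutionsWith_three {n : ℕ} (hn : n ∈ [10, 11, 12, 13]) :
    U n ∉ solutionsWith 3 n :=
  notMem_solutionsWith_three (p := 5) (by norm_num) le_rfl (by revert n; decide +kernel)

theorem V_notMem_solutionsWith_three {n : ℕ} (hn : n ∈ [11, 13]) : V n ∉ solutionsWith 3 n :=
  notMem_solutionsWith_three (p := 7) (by norm_num) (by norm_num) (by revert n; decide +kernel)

theorem U_ne_V {n : ℕ} (hn : n ∈ [11, 13]) : U n ≠ V n := by
  revert n; decide +kernel

theorem finite_setOf_mem {α : Type*} (L : List α) : {x | x ∈ L}.Finite := L.finite_toSet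

theorem ncard_union_singleton {α : Type*} {s : Set α} (hs : s.Finite) {a : α} (ha : a ∉ s) :
    (s ∪ {a}).ncard = s.ncard + 1 := by
  rw [Set.union_singleton, Set.ncard_insert_of_notMem ha hs]

theorem ncard_union_pair {α : Type*} {s : Set α} (hs : s.Finite) {a b : α} (ha : a ∉ s)
    (hb : b ∉ s) (hab : a ≠ b) : (s ∪ {a, b}).ncard = s.ncard + 2 := by
  have : s ∪ {a, b} = insert a (insert b s) := by
    ext x
    simp only [Set.mem_union, Set.mem_insert_iff, Set.mem_singleton_iff]
    tauto
  rw [this, Set.ncard_insert_of_notMem _ (hs.insert b), Set.ncard_insert_of_notMem hb hs]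
  simp [hab, ha]

theorem theorem3 :
    -- the number of solutions
    ((solutions 10).ncard = 101 ∧ (solutions 11).ncard = 192 ∧
      (solutions 12).ncard = 363 ∧ (solutions 13).ncard = 692) ∧
    -- the number of solutions with `q = 3`
    ((solutionsWith 3 10).ncard = 100 ∧ (solutionsWith 3 11).ncard = 190 ∧
      (solutionsWith 3 12).ncard = 362 ∧ (solutionsWith 3 13).ncard = 690) ∧
    -- the solutions with `q = 3` are the ones listed, and the lists do not repeat themselves
    (solutionsWith 3 10 = {X | X ∈ list10} ∧ list10.Nodup) ∧
    (solutionsWith 3 11 = {X | X ∈ list11} ∧ list11.Nodup) ∧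
    (solutionsWith 3 12 = {X | X ∈ list12} ∧ list12.Nodup) ∧
    (solutionsWith 3 13 = {X | X ∈ list13} ∧ list13.Nodup) ∧
    -- the solutions with `q = 5`
    (solutionsWith 5 10 = {U 10} ∧ solutionsWith 5 11 = {U 11} ∧
      solutionsWith 5 12 = {U 12} ∧ solutionsWith 5 13 = {U 13}) ∧
    -- the solutions with `q = 7`
    (solutionsWith 7 10 = ∅ ∧ solutionsWith 7 11 = {V 11} ∧
      solutionsWith 7 12 = ∅ ∧ solutionsWith 7 13 = {V 13}) ∧
    -- there are no others
    (solutions 10 = solutionsWith 3 10 ∪ {U 10} ∧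
      solutions 11 = solutionsWith 3 11 ∪ {U 11, V 11} ∧
      solutions 12 = solutionsWith 3 12 ∪ {U 12} ∧
      solutions 13 = solutionsWith 3 13 ∪ {U 13, V 13}) := by
  obtain ⟨e10, d10⟩ := solutionsWith_three_ten
  obtain ⟨e11, d11⟩ := solutionsWith_three_eleven
  obtain ⟨e12, d12⟩ := solutionsWith_three_twelve
  obtain ⟨e13, d13⟩ := solutionsWith_three_thirteen
  have f10 : (solutionsWith 3 10).Finite := e10 ▸ finite_setOf_mem list10
  have f11 : (solutionsWith 3 11).Finite := e11 ▸ finite_setOf_mem list11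
  have f12 : (solutionsWith 3 12).Finite := e12 ▸ finite_setOf_mem list12
  have f13 : (solutionsWith 3 13).Finite := e13 ▸ finite_setOf_mem list13
  have c10 : (solutionsWith 3 10).ncard = 100 := by rw [e10, ncard_setOf_mem d10]; decide +kernel
  have c11 : (solutionsWith 3 11).ncard = 190 := by rw [e11, ncard_setOf_mem d11]; decide +kernel
  have c12 : (solutionsWith 3 12).ncard = 362 := by rw [e12, ncard_setOf_mem d12]; decide +kernel
  have c13 : (solutionsWith 3 13).ncard = 690 := by rw [e13, ncard_setOf_mem d13]; decide +kernel
  have u10 : solutionsWith 5 10 = {U 10} := solutionsWith_five (by simp)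
  have u11 : solutionsWith 5 11 = {U 11} := solutionsWith_five (by simp)
  have u12 : solutionsWith 5 12 = {U 12} := solutionsWith_five (by simp)
  have u13 : solutionsWith 5 13 = {U 13} := solutionsWith_five (by simp)
  have v10 : solutionsWith 7 10 = ∅ := solutionsWith_seven_of_even (by simp)
  have v11 : solutionsWith 7 11 = {V 11} := solutionsWith_seven_of_odd (by simp)
  have v12 : solutionsWith 7 12 = ∅ := solutionsWith_seven_of_even (by simp)
  have v13 : solutionsWith 7 13 = {V 13} := solutionsWith_seven_of_odd (by simp)
  have s10 : solutions 10 = solutionsWith 3 10 ∪ {U 10} := by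
    rw [solutions_eq_union (by norm_num), u10, v10, Set.union_empty]
  have s11 : solutions 11 = solutionsWith 3 11 ∪ {U 11, V 11} := by
    rw [solutions_eq_union (by norm_num), u11, v11, Set.union_assoc, Set.singleton_union]
  have s12 : solutions 12 = solutionsWith 3 12 ∪ {U 12} := by
    rw [solutions_eq_union (by norm_num), u12, v12, Set.union_empty]
  have s13 : solutions 13 = solutionsWith 3 13 ∪ {U 13, V 13} := by
    rw [solutions_eq_union (by norm_num), u13, v13, Set.union_assoc, Set.singleton_union]
  refine ⟨⟨?_, ?_, ?_, ?_⟩, ⟨c10, c11, c12, c13⟩, ⟨e10, d10⟩, ⟨e11, d11⟩, ⟨e12, d12⟩,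
    ⟨e13, d13⟩, ⟨u10, u11, u12, u13⟩, ⟨v10, v11, v12, v13⟩, ⟨s10, s11, s12, s13⟩⟩
  · rw [s10, ncard_union_singleton f10 (U_notMem_solutionsWith_three (by simp)), c10]
  · rw [s11, ncard_union_pair f11 (U_notMem_solutionsWith_three (by simp))
      (V_notMem_solutionsWith_three (by simp)) (U_ne_V (by simp)), c11]
  · rw [s12, ncard_union_singleton f12 (U_notMem_solutionsWith_three (by simp)), c12]
  · rw [s13, ncard_union_pair f13 (U_notMem_solutionsWith_three (by simp))
      (V_notMem_solutionsWith_three (by simp)) (U_ne_V (by simp)), c13]
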